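/- Let $d\ge 4$, $K_d=d(d+3)/2$, and let $F(a,z)=\sum_{k+m+n=d}a_{k,m,n}z_1^kz_2^mz_3^n$ be the universal form of degree $d$. For $a\in\mathbb P^{K_d}$ (over $\mathbb C$) let $C_a\subset\mathbb P^2$ be the curve $F(a,z)=0$. Let $$\mathcal I_d=\Big\{(a,z)\in\mathbb P^{K_d}\times\mathbb P^2 \;:\; F(a,z)=0,\ \det\Big(\tfrac{\partial^2F}{\partial z_i\partial z_j}(a,z)\Big)=0\Big\},$$ with the scheme structure given by these two equations. For $r\ge1$, an $r$-tuple inflection point of $C_a$ is a smooth point $p$ of $C_a$ at which the tangent line $L$ has intersection number $(L,C_a)_p=r+2$ with $C_a$. Let $\mathcal S_d\subset\mathbb P^{K_d}$ be the set of $a$ with $C_a$ singular, and let $\mathcal M_d\subset\mathbb P^{K_d}$ be the Zariski closure of the set of $a$ such that $C_a$ has an $r$-tuple inflection point for some $r\ge 2$. Let $D_{2,2},D_{2,2,1},D_{2,2,2}\subset\mathbb P^{K_d}$ be the sets of parameters of the curves of degree $d$ given respectively by equations of the form $$z_1z_3S(z_1,z_2,z_3)+z_2^4\big(R_1(z_1,z_2)+R_2(z_2,z_3)\big)=0,$$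 $$z_1z_3S(z_1,z_2,z_3)+z_2^4z_3R_1(z_2,z_3)+z_1^4R_2(z_1,z_2)=0,$$ $$z_1S(z_1,z_2,z_3)+z_2^4z_3^4R_1(z_2,z_3)=0,$$ where $S,R_1,R_2$ are homogeneous polynomials of the degrees that make every term of degree $d$ (a form of negative degree being zero). Let $$\mathfrak M_d=\mathcal M_d\setminus\Big(\overline{PGL(3,\mathbb C)\cdot(D_{2,2}\cup D_{2,2,1}\cup D_{2,2,2})}\cup\mathcal S_d\Big),$$ where $PGL(3,\mathbb C)$ acts on $\mathbb P^{K_d}$ by projective transformations of curves and the bar denotes Zariski closure. If $a_0\in\mathfrak M_d$ and $z_0$ is a $2$-tuple inflection point of $C_{a_0}$, then $(a_0,z_0)$ is a smooth point of $\mathcal I_d$. -/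

import Mathlib

namespace PlaneInflection

open MvPolynomial

noncomputable section

/-- Exponents `(k, m, n)` with `k + m + n = d`. -/
abbrev Exps (d : ℕ) : Type := Finset.piAntidiag (Finset.univ : Finset (Fin 3)) d

/-- The projective space `ℙ^{K_d}` of plane curves of degree `d`, with homogeneous coordinates
`a_{k,m,n}`, `k + m + n = d`. -/
abbrev CurveSpace (d : ℕ) : Type := Projectivization ℂ (Exps d → ℂ)

/-- The projective plane. -/
abbrev Plane : Type := Projectivization ℂ (Fin 3 → ℂ)

/-- The ring `ℂ[a, z]` of polynomials in the coefficients `a_{k,m,n}` and in `z₁, z₂, z₃`. -/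
abbrev CoeffCoordRing (d : ℕ) : Type := MvPolynomial (Exps d ⊕ Fin 3) ℂ

/-- The universal form `F(a, z) = ∑ a_{k,m,n} z₁^k z₂^m z₃^n`. -/
def universalForm (d : ℕ) : CoeffCoordRing d :=
  ∑ m : Exps d, X (Sum.inl m) * ∏ k : Fin 3, X (Sum.inr k) ^ (m : Fin 3 → ℕ) k

/-- The Hessian `det (∂²F / ∂z_i ∂z_j)` of the universal form. -/
def hessianForm (d : ℕ) : CoeffCoordRing d :=
  (Matrix.of fun i j : Fin 3 =>
    pderiv (Sum.inr i) (pderiv (Sum.inr j) (universalForm d))).det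

/-- The bihomogeneous ideal `(F, det (∂²F / ∂z_i ∂z_j))`, which cuts out the inflection variety
`𝓘_d = 𝓒_d ∩ 𝓗_d` in `ℙ^{K_d} × ℙ²`. -/
def inflectionIdeal (d : ℕ) : Ideal (CoeffCoordRing d) :=
  Ideal.span {universalForm d, hessianForm d}

/-- For a bihomogeneous ideal `I`, the ideal of the intersection of the subscheme `V(I)` of
`ℙ^{K_d} × ℙ²` with the affine chart `a_m ≠ 0, z_k ≠ 0`; the chart is realised as the affine space
`{a_m = 1, z_k = 1}`. -/
def chartIdeal {d : ℕ} (I : Ideal (CoeffCoordRing d)) (m : Exps d) (k : Fin 3) :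
    Ideal (CoeffCoordRing d) :=
  I ⊔ Ideal.span {X (Sum.inl m) - 1, X (Sum.inr k) - 1}

/-- The affine coordinates `(a / a_m, z / z_k)` of the point `(a, z)` in the chart
`a_m ≠ 0, z_k ≠ 0`. -/
def chartPoint {d : ℕ} (a : CurveSpace d) (z : Plane) (m : Exps d) (k : Fin 3) :
    Exps d ⊕ Fin 3 → ℂ :=
  Sum.elim (fun n => a.rep n / a.rep m) (fun l => z.rep l / z.rep k)

/-- `(a, z)` is a smooth point of the subscheme `V(I)` of `ℙ^{K_d} × ℙ²`: in every standard affine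
chart around `(a, z)`, the point `(a, z)` is a point of the spectrum of the coordinate ring of
`V(I)` in that chart (in other words it lies on `V(I)`), and this spectrum is smooth over `ℂ`
there. -/
def IsSmoothPoint {d : ℕ} (I : Ideal (CoeffCoordRing d)) (a : CurveSpace d) (z : Plane) : Prop :=
  ∀ (m : Exps d) (k : Fin 3), a.rep m ≠ 0 → z.rep k ≠ 0 →
    ∃ x : PrimeSpectrum (CoeffCoordRing d ⧸ chartIdeal I m k),
      x.asIdeal.comap (Ideal.Quotient.mk (chartIdeal I m k)) =
        RingHom.ker (eval (chartPoint a z m k)) ∧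
      x ∈ Algebra.smoothLocus ℂ (CoeffCoordRing d ⧸ chartIdeal I m k)

/-- The form `F(a, ·)` defining the curve `C_a` (well defined up to a nonzero factor). -/
def curveForm {d : ℕ} (a : CurveSpace d) : MvPolynomial (Fin 3) ℂ :=
  aeval (Sum.elim (fun m => C (a.rep m)) X : Exps d ⊕ Fin 3 → MvPolynomial (Fin 3) ℂ)
    (universalForm d)

/-- The intersection number at `p` of the curve `F = 0` with the line through `p` and `q`: the order
of vanishing at `t = 0` of `F(p + t q)`. It is `⊤` if the line lies on the curve. -/
def lineIntersectionNumber (F : MvPolynomial (Fin 3) ℂ) (p q : Fin 3 → ℂ) : ℕ∞ :=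
  emultiplicity (Polynomial.X : Polynomial ℂ)
    (aeval (fun i => Polynomial.C (p i) + Polynomial.X * Polynomial.C (q i)) F)

/-- `z` is an `r`-tuple inflection point of `C_a`: it is a smooth point of `C_a`, and the tangent
line at `z` (spanned by `z` and `q`) has intersection number `r + 2` with `C_a` at `z`. -/
def IsInflectionPoint {d : ℕ} (r : ℕ) (a : CurveSpace d) (z : Plane) : Prop :=
  1 ≤ r ∧ eval z.rep (curveForm a) = 0 ∧ (∃ i, eval z.rep (pderiv i (curveForm a)) ≠ 0) ∧
    ∃ q : Fin 3 → ℂ, LinearIndependent ℂ ![z.rep, q] ∧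
      ∑ i, eval z.rep (pderiv i (curveForm a)) * q i = 0 ∧
      lineIntersectionNumber (curveForm a) z.rep q = ((r + 2 : ℕ) : ℕ∞)

/-- The Zariski closure of a subset of `ℙ^{K_d}`. -/
def zariskiClosure {d : ℕ} (S : Set (CurveSpace d)) : Set (CurveSpace d) :=
  {a | ∀ (f : MvPolynomial (Exps d) ℂ) (n : ℕ), f.IsHomogeneous n →
    (∀ b ∈ S, eval b.rep f = 0) → eval a.rep f = 0}

/-- `𝓢_d`: the parameters of singular curves. -/
def singularCurves (d : ℕ) : Set (CurveSpace d) :=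
  {a | ∃ z : Plane, eval z.rep (curveForm a) = 0 ∧
    ∀ i, eval z.rep (pderiv i (curveForm a)) = 0}

/-- `𝓜_d`: the closure of the set of parameters of curves with an `r`-tuple inflection point,
`r ≥ 2`. -/
def multipleInflectionCurves (d : ℕ) : Set (CurveSpace d) :=
  zariskiClosure {a | ∃ r : ℕ, 2 ≤ r ∧ ∃ z : Plane, IsInflectionPoint r a z}

/-- `D_{2,2}`: the curves `z₁ z₃ S(z₁,z₂,z₃) + z₂⁴ (R₁(z₁,z₂) + R₂(z₂,z₃)) = 0`, with
`deg S = d - 2`, `deg R₁ = deg R₂ = d - 4`. Homogeneity is imposed on the products, so that a form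
of negative degree is zero. -/
def D22 (d : ℕ) : Set (CurveSpace d) :=
  {a | ∃ S R₁ R₂ : MvPolynomial (Fin 3) ℂ,
    R₁ ∈ supported ℂ {0, 1} ∧ R₂ ∈ supported ℂ {1, 2} ∧
    (X 0 * X 2 * S).IsHomogeneous d ∧ (X 1 ^ 4 * R₁).IsHomogeneous d ∧
    (X 1 ^ 4 * R₂).IsHomogeneous d ∧
    curveForm a = X 0 * X 2 * S + X 1 ^ 4 * (R₁ + R₂)}

/-- `D_{2,2,1}`: the curves `z₁ z₃ S(z₁,z₂,z₃) + z₂⁴ z₃ R₁(z₂,z₃) + z₁⁴ R₂(z₁,z₂) = 0`, with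
`deg S = d - 2`, `deg R₁ = d - 5`, `deg R₂ = d - 4`. -/
def D221 (d : ℕ) : Set (CurveSpace d) :=
  {a | ∃ S R₁ R₂ : MvPolynomial (Fin 3) ℂ,
    R₁ ∈ supported ℂ {1, 2} ∧ R₂ ∈ supported ℂ {0, 1} ∧
    (X 0 * X 2 * S).IsHomogeneous d ∧ (X 1 ^ 4 * X 2 * R₁).IsHomogeneous d ∧
    (X 0 ^ 4 * R₂).IsHomogeneous d ∧
    curveForm a = X 0 * X 2 * S + X 1 ^ 4 * X 2 * R₁ + X 0 ^ 4 * R₂}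

/-- `D_{2,2,2}`: the curves `z₁ S(z₁,z₂,z₃) + z₂⁴ z₃⁴ R₁(z₂,z₃) = 0`, with
`deg S = d - 1`, `deg R₁ = d - 8`. -/
def D222 (d : ℕ) : Set (CurveSpace d) :=
  {a | ∃ S R₁ : MvPolynomial (Fin 3) ℂ,
    R₁ ∈ supported ℂ {1, 2} ∧
    (X 0 * S).IsHomogeneous d ∧ (X 1 ^ 4 * X 2 ^ 4 * R₁).IsHomogeneous d ∧
    curveForm a = X 0 * S + X 1 ^ 4 * X 2 ^ 4 * R₁}

/-- `ν(PGL(3, ℂ) × D)`: the parameters `a` of the curves `C_a = g(C_b)`, `g ∈ PGL(3, ℂ)`, `b ∈ D`.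
The curve `C_a` is `g(C_b)` when `F(a, g z)` and `F(b, z)` are proportional. -/
def projectiveOrbit {d : ℕ} (D : Set (CurveSpace d)) : Set (CurveSpace d) :=
  {a | ∃ g : Matrix.GeneralLinearGroup (Fin 3) ℂ, ∃ b ∈ D, ∃ c : ℂ, c ≠ 0 ∧
    aeval (fun i => ∑ j, C ((g : Matrix (Fin 3) (Fin 3) ℂ) i j) * X j) (curveForm a) =
      (C c * curveForm b : MvPolynomial (Fin 3) ℂ)}

/-- The open part `𝔐_d` of `𝓜_d`. -/
def openMultipleInflectionCurves (d : ℕ) : Set (CurveSpace d) :=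
  multipleInflectionCurves d \
    (zariskiClosure (projectiveOrbit (D22 d ∪ D221 d ∪ D222 d)) ∪ singularCurves d)

end

end PlaneInflection

/-! Let `A` be the matrix of second derivatives of `F` at a smooth point `z` of the curve. Euler's
identity gives `A z = (d - 1) ∇F ≠ 0` and, since `F` vanishes at `z`, `zᵀ A z = 0`. At an inflection
point the tangent line has contact at least three, so its plane in `ℂ³` is isotropic for `A`; hence
`det A = 0` and the point lies on the inflection scheme (`IsInflectionPoint.eval_hessianForm`).

For smoothness it is enough to move the coefficients `a`. Adding `z_k^d` changes `F` to first order.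
Adding `L² z_k^(d-2)`, where the linear form `L` has coefficient vector `z × e_i`, leaves `F`
unchanged at `z` and changes `det A` at the rate `2 lᵀ adj(A) l = -2 (A z)_i²` for `l = z × e_i`
(`sum_adjugate_ne_zero`); this is nonzero when `∂F/∂z_i ≠ 0`. So the differentials of `F` and of the
Hessian are independent.

A chart is cut out by the further equations `a_m = 1` and `z_k = 1`. The two Euler fields annihilate
both bihomogeneous equations at the point and are transverse to these normalisations, which makes a
4 × 4 Jacobian triangular (`exists_mem_smoothLocus_chartIdeal`). -/

namespace PlaneInflection

open MvPolynomial

/-! ### Jacobian criterion for arbitrary derivations, by lifting along square-zero extensions. -/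

section JacobianCriterion

universe u

/-- A homomorphism on a polynomial ring may be perturbed by derivations with coefficients in a
square-zero ideal. -/
lemma exists_algHom_eq_add_derivations {R σ ι B : Type*} [CommRing R] [CommRing B] [Algebra R B]
    [Fintype ι] (D : ι → Derivation R (MvPolynomial σ R) (MvPolynomial σ R))
    (φ : MvPolynomial σ R →ₐ[R] B) (ε : ι → B) (hε : ∀ i j, ε i * ε j = 0) :
    ∃ ψ : MvPolynomial σ R →ₐ[R] B, ∀ p, ψ p = φ p + ∑ i, ε i * φ (D i p) := by
  refine ⟨aeval fun s => φ (X s) + ∑ i, ε i * φ (D i (X s)), fun p => ?_⟩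
  induction p using MvPolynomial.induction_on with
  | C r => simp [← MvPolynomial.algebraMap_eq]
  | add p q hp hq =>
    simp only [map_add, hp, hq, mul_add, Finset.sum_add_distrib]
    ring
  | mul_X p s hp =>
    -- The second-order term is the only obstruction to multiplicativity, and it dies because the `ε
    -- i` multiply to zero.
    have hz : (∑ i, ε i * φ (D i p)) * (∑ i, ε i * φ (D i (X s))) = 0 := by
      rw [Finset.sum_mul_sum]
      refine Finset.sum_eq_zero fun i _ => Finset.sum_eq_zero fun j _ => ?_
      rw [mul_mul_mul_comm, hε, zero_mul]
    have hl : ∑ i, ε i * φ (D i (p * X s)) =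
        φ p * (∑ i, ε i * φ (D i (X s))) + φ (X s) * ∑ i, ε i * φ (D i p) := by
      rw [Finset.mul_sum, Finset.mul_sum, ← Finset.sum_add_distrib]
      refine Finset.sum_congr rfl fun i _ => ?_
      rw [Derivation.leibniz, smul_eq_mul, smul_eq_mul, map_add, map_mul, map_mul]
      ring
    rw [map_mul, hp, aeval_X, hl, map_mul]
    linear_combination hz

/-- Jacobian criterion, with arbitrary derivations in place of partial derivatives: the open set
where `det (D i (f j))` is invertible in the zero locus of the `f j` is formally smooth. -/
theorem formallySmooth_away_det {R σ ι : Type u} [CommRing R] [Fintype ι] [DecidableEq ι]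
    (f : ι → MvPolynomial σ R)
    (D : ι → Derivation R (MvPolynomial σ R) (MvPolynomial σ R)) :
    Algebra.FormallySmooth R (Localization.Away (Ideal.Quotient.mk (Ideal.span (Set.range f))
      (Matrix.of fun i j => D i (f j)).det)) := by
  set I := Ideal.span (Set.range f)
  set g := (Matrix.of fun i j => D i (f j)).det
  set S := Localization.Away (Ideal.Quotient.mk I g)
  refine Algebra.FormallySmooth.of_comp_surjective fun B _ _ J hJ h => ?_
  let π : MvPolynomial σ R →ₐ[R] S :=
    (IsScalarTower.toAlgHom R (MvPolynomial σ R ⧸ I) S).comp (Ideal.Quotient.mkₐ R I)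
  have hJ2 : ∀ x ∈ J, ∀ y ∈ J, x * y = 0 := fun x hx y hy => by
    have := Ideal.mul_mem_mul hx hy
    rwa [← pow_two, hJ, Ideal.mem_bot] at this
  -- A polynomial ring lifts freely; the lift `φ` sends each `f j` only into `J`, and has to be
  -- corrected to kill it.
  obtain ⟨φ, hφ⟩ := Algebra.FormallySmooth.comp_surjective R (MvPolynomial σ R) J hJ (h.comp π)
  have hφ' : ∀ p, Ideal.Quotient.mk J (φ p) = h (π p) := fun p => AlgHom.congr_fun hφ p
  have hfJ : ∀ j, φ (f j) ∈ J := fun j => by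
    rw [← Ideal.Quotient.eq_zero_iff_mem, hφ']
    have : Ideal.Quotient.mk I (f j) = 0 :=
      Ideal.Quotient.eq_zero_iff_mem.2 (Ideal.subset_span ⟨j, rfl⟩)
    simp [π, this]
  have hπg : IsUnit (π g) :=
    IsLocalization.Away.algebraMap_isUnit (S := S) (Ideal.Quotient.mk I g)
  have hunit : ∀ b : B, IsUnit (Ideal.Quotient.mk J b) → IsUnit b := fun b hb =>
    (IsNilpotent.isUnit_quotient_mk_iff ⟨2, hJ⟩).1 hb
  have hφg : IsUnit (φ g) := hunit _ (by rw [hφ']; exact hπg.map h)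
  let M : Matrix ι ι B := Matrix.of fun i j => φ (D i (f j))
  have hM : IsUnit M.det := by
    have : M.det = φ g := by
      rw [AlgHom.map_det]; rfl
    rwa [this]
  let v : ι → B := fun j => φ (f j)
  -- One Newton step: `ε` solves `ε M = -v`, and it is exact because `J ^ 2 = 0`.
  let ε : ι → B := -(Matrix.vecMul v M⁻¹)
  have hεJ : ∀ i, ε i ∈ J := fun i => by
    refine J.neg_mem (J.sum_mem fun j _ => J.mul_mem_right _ (hfJ j))
  have hεM : Matrix.vecMul ε M = -v := by
    simp only [ε, Matrix.neg_vecMul, Matrix.vecMul_vecMul, Matrix.nonsing_inv_mul _ hM,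
      Matrix.vecMul_one]
  obtain ⟨ψ, hψ⟩ := exists_algHom_eq_add_derivations D φ ε
    fun i j => hJ2 _ (hεJ i) _ (hεJ j)
  have hψφ : ∀ p, Ideal.Quotient.mk J (ψ p) = h (π p) := fun p => by
    rw [← hφ', hψ, Ideal.Quotient.eq, add_sub_cancel_left]
    exact J.sum_mem fun i _ => J.mul_mem_right _ (hεJ i)
  have hψf : ∀ j, ψ (f j) = 0 := fun j => by
    have : ∑ i, ε i * φ (D i (f j)) = -φ (f j) := congrFun hεM j
    rw [hψ, this, add_neg_cancel]
  have hψI : ∀ p ∈ I, ψ p = 0 := fun p hp => by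
    have : I ≤ RingHom.ker ψ := Ideal.span_le.2 (by rintro _ ⟨j, rfl⟩; exact hψf j)
    exact this hp
  let χ : MvPolynomial σ R ⧸ I →ₐ[R] B := Ideal.Quotient.liftₐ I ψ hψI
  have hχ : ∀ p, χ (Ideal.Quotient.mk I p) = ψ p := fun p => rfl
  -- Needed to extend `χ` to the localization: `g` is a unit modulo `J`, and `J` is nilpotent.
  have hχg : IsUnit (χ (Ideal.Quotient.mk I g)) :=
    hunit _ (by rw [hχ, hψφ]; exact hπg.map h)
  have hpow : ∀ y : Submonoid.powers (Ideal.Quotient.mk I g), IsUnit (χ y) := by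
    rintro ⟨_, n, rfl⟩
    simpa using hχg.pow n
  refine ⟨IsLocalization.liftAlgHom (M := Submonoid.powers (Ideal.Quotient.mk I g)) hpow, ?_⟩
  refine IsLocalization.algHom_ext (Submonoid.powers (Ideal.Quotient.mk I g)) ?_
  refine Ideal.Quotient.algHom_ext _ (AlgHom.ext fun p => ?_)
  have := hψφ p
  simpa [Algebra.algHom, π, hχ] using this

/-- Jacobian criterion at a rational point of a subscheme of affine space. -/
theorem exists_mem_smoothLocus_of_det_ne_zero {K σ ι : Type u} [Field K] [Finite σ] [Fintype ι]
    [DecidableEq ι] (f : ι → MvPolynomial σ K)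
    (D : ι → Derivation K (MvPolynomial σ K) (MvPolynomial σ K)) (x : σ → K)
    (hx : ∀ j, eval x (f j) = 0)
    (hdet : (Matrix.of fun i j => eval x (D i (f j))).det ≠ 0)
    {I : Ideal (MvPolynomial σ K)} (hI : I = Ideal.span (Set.range f)) :
    ∃ p : PrimeSpectrum (MvPolynomial σ K ⧸ I),
      p.asIdeal.comap (Ideal.Quotient.mk I) = RingHom.ker (eval x) ∧
      p ∈ Algebra.smoothLocus K (MvPolynomial σ K ⧸ I) := by
  subst hI
  set I := Ideal.span (Set.range f)
  have hIx : ∀ p ∈ I, eval x p = 0 := fun p hp => by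
    have : I ≤ RingHom.ker (eval x) := Ideal.span_le.2 (by rintro _ ⟨j, rfl⟩; exact hx j)
    exact this hp
  let e := Ideal.Quotient.lift I (eval x) hIx
  let p : PrimeSpectrum (MvPolynomial σ K ⧸ I) := ⟨RingHom.ker e, RingHom.ker_isPrime e⟩
  refine ⟨p, ?_, ?_⟩
  · ext q
    simp [p, e, RingHom.mem_ker]
  · have : Algebra.FinitePresentation K (MvPolynomial σ K ⧸ I) :=
      Algebra.FinitePresentation.quotient (IsNoetherian.noetherian I)
    refine Algebra.basicOpen_subset_smoothLocus_iff.2 (formallySmooth_away_det f D) ?_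
    change Ideal.Quotient.mk I _ ∉ RingHom.ker e
    rw [RingHom.mem_ker, Ideal.Quotient.lift_mk, RingHom.map_det]
    exact hdet

end JacobianCriterion

end PlaneInflection

namespace PlaneInflection

open MvPolynomial

/-! ### Euler derivations, weighted homogeneity, and restriction of a form to a line. -/

section General

lemma mkDerivation_eq_sum {R σ : Type*} [CommRing R] [Fintype σ] (f : σ → MvPolynomial σ R)
    (p : MvPolynomial σ R) : mkDerivation R f p = ∑ i, f i * pderiv i p := by
  classical
  induction p using MvPolynomial.induction_on with
  | C r => simp
  | add p q hp hq => simp only [map_add, hp, hq, mul_add, Finset.sum_add_distrib]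
  | mul_X p s hp =>
    rw [Derivation.leibniz, hp, mkDerivation_X]
    simp only [Derivation.leibniz, pderiv_X, smul_eq_mul, mul_add, Finset.sum_add_distrib,
      Finset.mul_sum, Pi.single_apply, mul_ite, mul_one, mul_zero, Finset.sum_ite_eq,
      Finset.mem_univ, if_true]
    congr 1
    · ring
    · exact Finset.sum_congr rfl fun i _ => by ring

/-- The Euler derivation of a grading of a polynomial ring by weights of the variables. -/
noncomputable def weightedEuler {σ : Type*} (w : σ → ℕ) :
    Derivation ℂ (MvPolynomial σ ℂ) (MvPolynomial σ ℂ) :=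
  mkDerivation ℂ fun i => w i • X i

lemma weightedEuler_eq {σ : Type*} [Fintype σ] {w : σ → ℕ} {n : ℕ} {p : MvPolynomial σ ℂ}
    (hp : p.IsWeightedHomogeneous w n) : weightedEuler w p = n • p := by
  rw [weightedEuler, mkDerivation_eq_sum, ← hp.sum_weight_X_mul_pderiv]
  exact Finset.sum_congr rfl fun i _ => smul_mul_assoc _ _ _

lemma eval_weighted_scale {σ : Type*} [Fintype σ] {w : σ → ℕ} {n : ℕ} {p : MvPolynomial σ ℂ}
    (hp : p.IsWeightedHomogeneous w n) (t : ℂ) (x : σ → ℂ) :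
    eval (fun i => t ^ w i * x i) p = t ^ n * eval x p := by
  rw [eval_eq', eval_eq', Finset.mul_sum]
  refine Finset.sum_congr rfl fun m hm => ?_
  have hw : ∑ i, m i * w i = n := by
    have := hp (mem_support_iff.1 hm)
    rwa [Finsupp.weight_apply, Finsupp.sum_fintype _ _ (by simp)] at this
  simp_rw [mul_pow, Finset.prod_mul_distrib, ← pow_mul, Finset.prod_pow_eq_pow_sum]
  rw [← hw]
  simp_rw [mul_comm (w _)]
  ring

lemma isWeightedHomogeneous_det {σ n : Type*} [Fintype n] [DecidableEq n] {w : σ → ℕ} {e : ℕ}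
    {M : Matrix n n (MvPolynomial σ ℂ)} (hM : ∀ i j, (M i j).IsWeightedHomogeneous w e) :
    M.det.IsWeightedHomogeneous w (Fintype.card n * e) := by
  rw [Matrix.det_apply]
  refine IsWeightedHomogeneous.sum _ _ _ fun τ _ => ?_
  have h : (∏ i, M (τ i) i).IsWeightedHomogeneous w (Fintype.card n * e) := by
    have := IsWeightedHomogeneous.prod Finset.univ (fun i => M (τ i) i) (fun _ => e)
      fun i _ => hM (τ i) i
    simpa using this
  rcases Int.units_eq_one_or (Equiv.Perm.sign τ) with h1 | h1
  · rw [h1, one_smul]; exact h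
  · rw [h1, Units.neg_smul, one_smul]; exact h.neg

/-- The commutator of two derivations is a derivation, so it is determined by its values on the
variables. -/
lemma derivation_comm_of_X {σ : Type*} (D E : Derivation ℂ (MvPolynomial σ ℂ) (MvPolynomial σ ℂ))
    (h : ∀ s, D (E (X s)) = E (D (X s))) (p : MvPolynomial σ ℂ) : D (E p) = E (D p) := by
  have : ⁅D, E⁆ = 0 := derivation_ext fun s => by
    rw [Derivation.commutator_apply, h, sub_self]; rfl
  have := congrArg (fun F => F p) this
  exact sub_eq_zero.1 ((Derivation.commutator_apply ..).symm.trans this)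

/-- The chain rule; used twice, it expresses the second derivative along a line through the Hessian.
-/
lemma derivative_aeval_line (F : MvPolynomial (Fin 3) ℂ) (p q : Fin 3 → ℂ) :
    Polynomial.derivative
      (aeval (fun i => Polynomial.C (p i) + Polynomial.X * Polynomial.C (q i)) F) =
    ∑ i, Polynomial.C (q i) *
      aeval (fun i => Polynomial.C (p i) + Polynomial.X * Polynomial.C (q i)) (pderiv i F) := by
  induction F using MvPolynomial.induction_on with
  | C r => simp
  | add F G hF hG => simp only [map_add, hF, hG, mul_add, Finset.sum_add_distrib]
  | mul_X F s hF =>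
    rw [map_mul, Polynomial.derivative_mul, hF]
    simp only [Derivation.leibniz, pderiv_X, smul_eq_mul, mul_add, Finset.sum_add_distrib,
      Finset.sum_mul, Pi.single_apply, mul_ite, mul_one, mul_zero, map_add, map_mul, aeval_X,
      apply_ite (aeval _), map_zero, Finset.sum_ite_eq, Finset.mem_univ, if_true]
    simp only [Polynomial.derivative_C, Polynomial.derivative_mul,
      Polynomial.derivative_X, zero_add, one_mul, mul_zero, add_zero]
    rw [add_comm]
    congr 1
    · ring
    · rw [← Finset.sum_add_distrib]
      exact Finset.sum_congr rfl fun i _ => by ring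

lemma eval_zero_aeval_line (F : MvPolynomial (Fin 3) ℂ) (p q : Fin 3 → ℂ) :
    Polynomial.eval 0
      (aeval (fun i => Polynomial.C (p i) + Polynomial.X * Polynomial.C (q i)) F) = eval p F := by
  induction F using MvPolynomial.induction_on with
  | C r => simp
  | add F G hF hG => rw [map_add, map_add, Polynomial.eval_add, hF, hG]
  | mul_X F s hF =>
    rw [map_mul, map_mul, Polynomial.eval_mul, hF, aeval_X, eval_X]
    simp

/-- A line with intersection number at least three is isotropic for the Hessian. -/
lemma sum_hessian_eq_zero_of_lineIntersectionNumber {F : MvPolynomial (Fin 3) ℂ}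
    {p q : Fin 3 → ℂ} (h : 3 ≤ lineIntersectionNumber F p q) :
    ∑ i, ∑ j, q i * q j * eval p (pderiv i (pderiv j F)) = 0 := by
  have hdvd : (Polynomial.X : Polynomial ℂ) ^ 3 ∣
      aeval (fun i => Polynomial.C (p i) + Polynomial.X * Polynomial.C (q i)) F :=
    pow_dvd_of_le_emultiplicity (by exact_mod_cast h)
  obtain ⟨g, hg⟩ := hdvd
  have h2 := congrArg (fun P => Polynomial.eval 0
    (Polynomial.derivative (Polynomial.derivative P))) hg
  simp only [derivative_aeval_line, Polynomial.derivative_sum, Polynomial.derivative_C_mul,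
    Polynomial.eval_finsetSum, Polynomial.eval_mul, Polynomial.eval_C, eval_zero_aeval_line,
    Finset.mul_sum] at h2
  rw [Finset.sum_comm]
  calc _ = _ := Finset.sum_congr rfl fun j _ => Finset.sum_congr rfl fun i _ => by ring
    _ = _ := h2
    -- The second derivative of `X ^ 3 * g` still has a factor `X`.
    _ = 0 := by simp [Polynomial.derivative_mul]

end General

/-! ### Determinant and adjugate of 3 × 3 matrices. -/

section LinearAlgebra

open Matrix

/-- A symmetric `3 × 3` matrix with an isotropic plane is singular. -/
lemma det_eq_zero_of_isotropic {K : Type*} [Field K] {A : Matrix (Fin 3) (Fin 3) K}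
    (hA : A.IsSymm) {z q : Fin 3 → K}
    (hzq : LinearIndependent K ![z, q]) (hzz : z ⬝ᵥ A *ᵥ z = 0) (hqz : q ⬝ᵥ A *ᵥ z = 0)
    (hqq : q ⬝ᵥ A *ᵥ q = 0) : A.det = 0 := by
  have hc := crossProduct_ne_zero_iff_linearIndependent.2 hzq
  obtain ⟨i, hi⟩ := Function.ne_iff.1 hc
  have hzq' : z ⬝ᵥ A *ᵥ q = 0 := by
    rw [dotProduct_mulVec, ← mulVec_transpose, hA.eq, dotProduct_comm]; exact hqz
  -- The index `i` has `(z × q) i ≠ 0`, so `e_i` completes `z, q` to a basis.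
  let G : Matrix (Fin 3) (Fin 3) K := ![Pi.single i 1, z, q]
  have hG : G.det ≠ 0 := by
    rw [← triple_product_eq_det]; simpa using hi
  -- In this basis the Gram matrix has a zero 2 × 2 block on `z, q`, which forces a 3 × 3
  -- determinant to vanish.
  have h0 : (G * A * Gᵀ).det = 0 := by
    have key : ∀ r s, (G * A * Gᵀ) r s = G r ⬝ᵥ A *ᵥ G s := fun r s => by
      rw [dotProduct_mulVec]; rfl
    rw [det_fin_three]
    simp only [key]
    have h1 : G 1 = z := rfl
    have h2 : G 2 = q := rfl
    simp only [h1, h2, hzz, hqz, hqq, hzq']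
    ring
  rw [det_mul, det_mul, det_transpose] at h0
  simpa [hG] using h0

/-- Jacobi's formula. -/
lemma derivation_det_fin_three {R P : Type*} [CommRing R] [CommRing P] [Algebra R P]
    (D : Derivation R P P) (M : Matrix (Fin 3) (Fin 3) P) :
    D M.det = ∑ i, ∑ j, M.adjugate j i * D (M i j) := by
  rw [det_fin_three]
  simp only [adjugate_fin_three, map_add, map_sub, Derivation.leibniz, smul_eq_mul,
    Fin.sum_univ_three]
  simp
  ring

lemma map_derivation_det_fin_three {R P K : Type*} [CommRing R] [CommRing P] [Algebra R P]
    [CommRing K] (φ : P →+* K) (D : Derivation R P P) (M : Matrix (Fin 3) (Fin 3) P) :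
    φ (D M.det) = ∑ i, ∑ j, (M.map φ).adjugate j i * φ (D (M i j)) := by
  have h : (M.map φ).adjugate = M.adjugate.map φ := (RingHom.map_adjugate φ M).symm
  simp only [derivation_det_fin_three, map_sum, map_mul, h, Matrix.map_apply]

/-- `adj(A)` evaluated on the covector `z × w`, as a Gram determinant. -/
lemma sum_adjugate_crossProduct {K : Type*} [CommRing K] {A : Matrix (Fin 3) (Fin 3) K}
    (z w : Fin 3 → K) :
    ∑ i, ∑ j, A.adjugate j i * ((z ⨯₃ w) i * (z ⨯₃ w) j) =
      (z ⬝ᵥ A *ᵥ z) * (w ⬝ᵥ A *ᵥ w) - (z ⬝ᵥ A *ᵥ w) * (w ⬝ᵥ A *ᵥ z) := by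
  simp only [adjugate_fin_three, cross_apply, mulVec, dotProduct, Fin.sum_univ_three]
  simp
  ring

end LinearAlgebra

end PlaneInflection

/-! ### Bihomogeneity of the two equations, and their derivatives along the coefficients. -/

namespace PlaneInflection

open MvPolynomial

noncomputable section

variable {d : ℕ}

/-- The degree of the variables of `ℂ[a, z]` in `a`. -/
def paramWeight (d : ℕ) : Exps d ⊕ Fin 3 → ℕ := Sum.elim (fun _ => 1) fun _ => 0

/-- The degree of the variables of `ℂ[a, z]` in `z`. -/
def coordWeight (d : ℕ) : Exps d ⊕ Fin 3 → ℕ := Sum.elim (fun _ => 0) fun _ => 1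

lemma universalForm_paramWeight (d : ℕ) :
    (universalForm d).IsWeightedHomogeneous (paramWeight d) 1 := by
  refine IsWeightedHomogeneous.sum _ _ _ fun m _ => ?_
  have h := (isWeightedHomogeneous_X ℂ (paramWeight d) (Sum.inl m)).mul
    (IsWeightedHomogeneous.prod Finset.univ
      (fun k : Fin 3 => (X (Sum.inr k) : CoeffCoordRing d) ^ (m : Fin 3 → ℕ) k) _
      fun k _ => (isWeightedHomogeneous_X ℂ (paramWeight d) (Sum.inr k)).pow _)
  simpa [paramWeight] using h

lemma sum_exps (m : Exps d) : ∑ k, (m : Fin 3 → ℕ) k = d := by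
  have := m.2
  rw [Finset.mem_piAntidiag] at this
  exact this.1

lemma universalForm_coordWeight (d : ℕ) :
    (universalForm d).IsWeightedHomogeneous (coordWeight d) d := by
  refine IsWeightedHomogeneous.sum _ _ _ fun m _ => ?_
  have h := (isWeightedHomogeneous_X ℂ (coordWeight d) (Sum.inl m)).mul
    (IsWeightedHomogeneous.prod Finset.univ
      (fun k : Fin 3 => (X (Sum.inr k) : CoeffCoordRing d) ^ (m : Fin 3 → ℕ) k) _
      fun k _ => (isWeightedHomogeneous_X ℂ (coordWeight d) (Sum.inr k)).pow _)
  simpa [coordWeight, sum_exps] using h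

lemma pderiv_paramWeight {p : CoeffCoordRing d} {n : ℕ}
    (hp : p.IsWeightedHomogeneous (paramWeight d) n) (i : Fin 3) :
    (pderiv (Sum.inr i) p).IsWeightedHomogeneous (paramWeight d) n :=
  hp.pderiv (by simp [paramWeight])

lemma pderiv_coordWeight {p : CoeffCoordRing d} {n : ℕ}
    (hp : p.IsWeightedHomogeneous (coordWeight d) (n + 1)) (i : Fin 3) :
    (pderiv (Sum.inr i) p).IsWeightedHomogeneous (coordWeight d) n :=
  hp.pderiv (by simp [coordWeight])

lemma hessianForm_paramWeight (d : ℕ) :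
    (hessianForm d).IsWeightedHomogeneous (paramWeight d) 3 := by
  have := isWeightedHomogeneous_det (w := paramWeight d) (e := 1)
    (M := Matrix.of fun i j : Fin 3 =>
      pderiv (Sum.inr i) (pderiv (Sum.inr j) (universalForm d)))
    fun i j => pderiv_paramWeight (pderiv_paramWeight (universalForm_paramWeight d) j) i
  simpa [hessianForm] using this

lemma hessianForm_coordWeight (e : ℕ) :
    (hessianForm (e + 2)).IsWeightedHomogeneous (coordWeight (e + 2)) (3 * e) := by
  have := isWeightedHomogeneous_det (w := coordWeight (e + 2)) (e := e)
    (M := Matrix.of fun i j : Fin 3 =>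
      pderiv (Sum.inr i) (pderiv (Sum.inr j) (universalForm (e + 2))))
    fun i j => pderiv_coordWeight (pderiv_coordWeight (universalForm_coordWeight (e + 2)) j) i
  simpa [hessianForm] using this

/-- The Euler identity in the variables `z`. -/
lemma sum_coord_mul_pderiv {p : CoeffCoordRing d} {n : ℕ}
    (hp : p.IsWeightedHomogeneous (coordWeight d) n) (x : Exps d ⊕ Fin 3 → ℂ) :
    ∑ i, x (Sum.inr i) * eval x (pderiv (Sum.inr i) p) = n * eval x p := by
  have h := congrArg (eval x) hp.sum_weight_X_mul_pderiv
  simpa [coordWeight] using h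

/-- The form of degree `d` with given coefficients. -/
def coeffForm (a : Exps d → ℂ) : MvPolynomial (Fin 3) ℂ :=
  ∑ m : Exps d, C (a m) * ∏ k : Fin 3, X k ^ (m : Fin 3 → ℕ) k

/-- Lets every form of degree `d` serve as a direction of deformation of the curve. -/
lemma exists_coeffForm_eq {G : MvPolynomial (Fin 3) ℂ} (hG : G.IsHomogeneous d) :
    ∃ a : Exps d → ℂ, coeffForm a = G := by
  classical
  refine ⟨fun m => coeff (Finsupp.equivFunOnFinite.symm m) G, ?_⟩
  have hmon : ∀ m : Exps d, (∏ k : Fin 3, X k ^ (m : Fin 3 → ℕ) k : MvPolynomial (Fin 3) ℂ) =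
      monomial (Finsupp.equivFunOnFinite.symm (m : Fin 3 → ℕ)) 1 := fun m => by
    rw [monomial_eq, Finsupp.prod_fintype _ _ (by simp)]
    simp
  ext n
  simp only [coeffForm, hmon, coeff_sum, coeff_C_mul, coeff_monomial, mul_ite, mul_one, mul_zero]
  by_cases hn : ∑ k, n k = d
  · have hmem : (n : Fin 3 → ℕ) ∈ Finset.piAntidiag (Finset.univ : Finset (Fin 3)) d := by
      rw [Finset.mem_piAntidiag]; exact ⟨hn, fun _ _ => Finset.mem_univ _⟩
    rw [Finset.sum_eq_single ⟨n, hmem⟩]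
    · simp
    · intro m _ hm
      rw [if_neg]
      rintro rfl
      exact hm (by ext; rfl)
    · simp
  · rw [hG.coeff_eq_zero (by rwa [Finsupp.degree_eq_sum])]
    refine Finset.sum_eq_zero fun m _ => if_neg ?_
    rintro rfl
    exact hn (sum_exps m)

/-- The derivation of `ℂ[a, z]` along a constant vector field in the variables `a`. -/
def paramDerivation (δ : Exps d → ℂ) : Derivation ℂ (CoeffCoordRing d) (CoeffCoordRing d) :=
  mkDerivation ℂ (Sum.elim (fun m => C (δ m)) fun _ => 0)

lemma paramDerivation_inl (δ : Exps d → ℂ) (m : Exps d) :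
    paramDerivation δ (X (Sum.inl m)) = C (δ m) := mkDerivation_X ..

lemma paramDerivation_inr (δ : Exps d → ℂ) (k : Fin 3) :
    paramDerivation δ (X (Sum.inr k)) = 0 := mkDerivation_X ..

/-- The universal form is linear in `a`, so its derivative in the direction `δ` is the form with
coefficients `δ`. -/
lemma paramDerivation_universalForm (δ : Exps d → ℂ) :
    paramDerivation δ (universalForm d) = rename Sum.inr (coeffForm δ) := by
  rw [universalForm, coeffForm, map_sum, map_sum]
  refine Finset.sum_congr rfl fun m _ => ?_
  have h0 : paramDerivation δ
      (∏ k : Fin 3, (X (Sum.inr k) : CoeffCoordRing d) ^ (m : Fin 3 → ℕ) k) = 0 := by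
    simp [Fin.prod_univ_three, Derivation.leibniz, Derivation.leibniz_pow, paramDerivation_inr]
  rw [Derivation.leibniz, h0, paramDerivation_inl]
  simp [mul_comm]

lemma paramDerivation_pderiv (δ : Exps d → ℂ) (i : Fin 3) (p : CoeffCoordRing d) :
    paramDerivation δ (pderiv (Sum.inr i) p) = pderiv (Sum.inr i) (paramDerivation δ p) := by
  classical
  refine derivation_comm_of_X _ _ (fun s => ?_) p
  rcases s with m | k
  · simp [paramDerivation_inl, pderiv_X]
  · rw [paramDerivation_inr, pderiv_X, Pi.single_apply]
    split_ifs <;> simp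

lemma eval_paramDerivation_universalForm (δ : Exps d → ℂ) (x : Exps d ⊕ Fin 3 → ℂ) :
    eval x (paramDerivation δ (universalForm d)) =
      eval (fun k => x (Sum.inr k)) (coeffForm δ) := by
  rw [paramDerivation_universalForm, eval_rename]; rfl

lemma eval_paramDerivation_hessian (δ : Exps d → ℂ) (x : Exps d ⊕ Fin 3 → ℂ) (i j : Fin 3) :
    eval x (paramDerivation δ (pderiv (Sum.inr i) (pderiv (Sum.inr j) (universalForm d)))) =
      eval (fun k => x (Sum.inr k)) (pderiv i (pderiv j (coeffForm δ))) := by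
  rw [paramDerivation_pderiv, paramDerivation_pderiv, paramDerivation_universalForm,
    pderiv_rename Sum.inr_injective, pderiv_rename Sum.inr_injective, eval_rename]; rfl

/-- Only the terms in which each factor `L` is differentiated once survive at a zero of `L`, so the
Hessian has rank at most one. -/
lemma eval_pderiv_pderiv_sq_mul {z : Fin 3 → ℂ} {L M : MvPolynomial (Fin 3) ℂ}
    (hL : eval z L = 0) (i j : Fin 3) :
    eval z (pderiv i (pderiv j (L ^ 2 * M))) =
      2 * (eval z (pderiv i L) * eval z (pderiv j L)) * eval z M := by
  simp only [pow_two, Derivation.leibniz, smul_eq_mul, map_add, map_mul, hL]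
  ring

lemma pderiv_pderiv_comm {σ : Type*} (i j : σ) (p : MvPolynomial σ ℂ) :
    pderiv i (pderiv j p) = pderiv j (pderiv i p) := by
  classical
  refine derivation_comm_of_X _ _ (fun t => ?_) p
  simp only [pderiv_X, Pi.single_apply]
  split_ifs <;> simp

/-- The matrix of second derivatives in `z` of the universal form at a point. -/
def hessianMatrix (x : Exps d ⊕ Fin 3 → ℂ) : Matrix (Fin 3) (Fin 3) ℂ :=
  Matrix.of fun r s => eval x (pderiv (Sum.inr r) (pderiv (Sum.inr s) (universalForm d)))

lemma hessianMatrix_isSymm (x : Exps d ⊕ Fin 3 → ℂ) : (hessianMatrix x).IsSymm := by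
  ext r s
  rw [Matrix.transpose_apply, hessianMatrix, Matrix.of_apply, Matrix.of_apply, pderiv_pderiv_comm]

lemma det_hessianMatrix (x : Exps d ⊕ Fin 3 → ℂ) :
    (hessianMatrix x).det = eval x (hessianForm d) := by
  rw [hessianForm, RingHom.map_det]; rfl

open Matrix

/-- Euler's identity for the first partials, of degree `e + 1`. Writing the degree as `e + 2` avoids
truncated subtraction. -/
lemma hessianMatrix_mulVec {e : ℕ} (x : Exps (e + 2) ⊕ Fin 3 → ℂ) (s : Fin 3) :
    (hessianMatrix x *ᵥ (fun l => x (Sum.inr l))) s =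
      ((e : ℂ) + 1) * eval x (pderiv (Sum.inr s) (universalForm (e + 2))) := by
  have := sum_coord_mul_pderiv
    (pderiv_coordWeight (n := e + 1) (universalForm_coordWeight (e + 2)) s) x
  rw [Nat.cast_add, Nat.cast_one] at this
  rw [← this, mulVec, dotProduct]
  refine Finset.sum_congr rfl fun r _ => ?_
  rw [mul_comm, hessianMatrix, of_apply, pderiv_pderiv_comm]

lemma dotProduct_hessianMatrix_mulVec {e : ℕ} {x : Exps (e + 2) ⊕ Fin 3 → ℂ}
    (hF : eval x (universalForm (e + 2)) = 0) :
    (fun l => x (Sum.inr l)) ⬝ᵥ hessianMatrix x *ᵥ (fun l => x (Sum.inr l)) = 0 := by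
  have h := sum_coord_mul_pderiv (universalForm_coordWeight (e + 2)) x
  rw [hF, mul_zero] at h
  calc _ = ((e : ℂ) + 1) *
        ∑ r, x (Sum.inr r) * eval x (pderiv (Sum.inr r) (universalForm (e + 2))) := by
        rw [Finset.mul_sum]
        exact Finset.sum_congr rfl fun r _ => by rw [hessianMatrix_mulVec]; ring
    _ = 0 := by rw [h, mul_zero]

lemma eval_paramDerivation_hessianForm (δ : Exps d → ℂ) (x : Exps d ⊕ Fin 3 → ℂ) :
    eval x (paramDerivation δ (hessianForm d)) = ∑ r, ∑ s, (hessianMatrix x).adjugate s r *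
      eval (fun k => x (Sum.inr k)) (pderiv r (pderiv s (coeffForm δ))) := by
  have hA : (of fun i j : Fin 3 =>
      pderiv (Sum.inr i) (pderiv (Sum.inr j) (universalForm d))).map (eval x) =
      hessianMatrix x := by
    ext r s
    rw [map_apply, of_apply, hessianMatrix, of_apply]
  rw [hessianForm, map_derivation_det_fin_three, hA]
  simp only [of_apply, eval_paramDerivation_hessian]

end

end PlaneInflection

/-! ### The deformations of the curve and the triangular Jacobian. -/

namespace PlaneInflection

open MvPolynomial Matrix

noncomputable section

/-- The square of a linear form vanishing at `z`, times a power of a coordinate. -/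
lemma exists_coeffForm_sq {e : ℕ} {z l : Fin 3 → ℂ} {k : Fin 3} (hk : z k = 1)
    (hl : z ⬝ᵥ l = 0) :
    ∃ δ : Exps (e + 2) → ℂ, eval z (coeffForm δ) = 0 ∧
      ∀ r s, eval z (pderiv r (pderiv s (coeffForm δ))) = 2 * (l r * l s) := by
  let L : MvPolynomial (Fin 3) ℂ := ∑ r, C (l r) * X r
  have hL : eval z L = 0 := by
    rw [dotProduct_comm] at hl
    simpa only [L, dotProduct, map_sum, map_mul, eval_C, eval_X] using hl
  have hLr : ∀ r, eval z (pderiv r L) = l r := fun r => by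
    simp [L, pderiv_X, Pi.single_apply]
  have hL1 : L.IsHomogeneous 1 := IsHomogeneous.sum _ _ _ fun r _ => isHomogeneous_C_mul_X _ _
  have hG : (L ^ 2 * X k ^ e).IsHomogeneous (e + 2) := by
    have := (hL1.pow 2).mul (isHomogeneous_X_pow (R := ℂ) k e)
    rwa [one_mul, add_comm] at this
  obtain ⟨δ, hδ⟩ := exists_coeffForm_eq hG
  refine ⟨δ, ?_, fun r s => ?_⟩
  · rw [hδ, map_mul, map_pow, hL, zero_pow two_ne_zero, zero_mul]
  · rw [hδ, eval_pderiv_pderiv_sq_mul hL, map_pow, eval_X, hk, hLr, hLr]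
    ring

/-- With `w = e_i`, the Gram determinant of `sum_adjugate_crossProduct` collapses to `-(A z)_i²`,
since `zᵀ A z = 0` and `A` is symmetric. -/
lemma sum_adjugate_ne_zero {A : Matrix (Fin 3) (Fin 3) ℂ} (hsymm : A.IsSymm) {z : Fin 3 → ℂ}
    {i : Fin 3} (hAz : (A *ᵥ z) i ≠ 0) (hzAz : z ⬝ᵥ A *ᵥ z = 0) :
    ∑ r, ∑ s, A.adjugate s r *
      (2 * ((z ⨯₃ (Pi.single i 1)) r * (z ⨯₃ (Pi.single i 1)) s)) ≠ 0 := by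
  have hwAz : (Pi.single i 1) ⬝ᵥ A *ᵥ z = (A *ᵥ z) i := by
    rw [single_dotProduct, one_mul]
  have hzAw : z ⬝ᵥ A *ᵥ (Pi.single i 1) = (A *ᵥ z) i := by
    rw [← hwAz, dotProduct_mulVec, ← mulVec_transpose, hsymm.eq, dotProduct_comm]
  simp_rw [mul_left_comm _ (2 : ℂ), ← Finset.mul_sum]
  rw [sum_adjugate_crossProduct, hzAz, hzAw, hwAz]
  simp [hAz]

/-- At a smooth point of a curve there is a deformation of the curve that keeps the point on it and
changes the Hessian to first order. -/
lemma exists_paramDerivation_hessianForm_ne_zero {e : ℕ} {x : Exps (e + 2) ⊕ Fin 3 → ℂ}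
    {k : Fin 3} (hk : x (Sum.inr k) = 1) (hF : eval x (universalForm (e + 2)) = 0)
    {i : Fin 3} (hi : eval x (pderiv (Sum.inr i) (universalForm (e + 2))) ≠ 0) :
    ∃ δ : Exps (e + 2) → ℂ, eval x (paramDerivation δ (universalForm (e + 2))) = 0 ∧
      eval x (paramDerivation δ (hessianForm (e + 2))) ≠ 0 := by
  have hAz : (hessianMatrix x *ᵥ (fun l => x (Sum.inr l))) i ≠ 0 := by
    rw [hessianMatrix_mulVec x i]
    exact mul_ne_zero (Nat.cast_add_one_ne_zero e) hi
  have hne := sum_adjugate_ne_zero (hessianMatrix_isSymm x) hAz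
    (dotProduct_hessianMatrix_mulVec hF)
  obtain ⟨δ, h1, h2⟩ := exists_coeffForm_sq (e := e) (z := fun l => x (Sum.inr l)) hk
    (dot_self_cross _ (Pi.single i 1))
  refine ⟨δ, (eval_paramDerivation_universalForm δ x).trans h1, ?_⟩
  have h3 := eval_paramDerivation_hessianForm δ x
  rw [h3]
  have h4 : ∀ r s, (hessianMatrix x).adjugate s r *
      eval (fun k => x (Sum.inr k)) (pderiv r (pderiv s (coeffForm δ))) =
      (hessianMatrix x).adjugate s r * (2 * (((fun l => x (Sum.inr l)) ⨯₃ (Pi.single i 1)) r *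
        ((fun l => x (Sum.inr l)) ⨯₃ (Pi.single i 1)) s)) := fun r s => by rw [h2 r s]
  rw [Finset.sum_congr rfl fun r _ => Finset.sum_congr rfl fun s _ => h4 r s]
  exact hne

lemma det_ne_zero_of_upper_fin_four {K : Type*} [Field K] {M : Matrix (Fin 4) (Fin 4) K}
    (h10 : M 1 0 = 0) (h20 : M 2 0 = 0) (h21 : M 2 1 = 0) (h30 : M 3 0 = 0) (h31 : M 3 1 = 0)
    (h32 : M 3 2 = 0) (h00 : M 0 0 ≠ 0) (h11 : M 1 1 ≠ 0) (h22 : M 2 2 ≠ 0) (h33 : M 3 3 ≠ 0) :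
    M.det ≠ 0 := by
  rw [det_of_isUpperTriangular, Fin.prod_univ_four]
  · exact mul_ne_zero (mul_ne_zero (mul_ne_zero h00 h11) h22) h33
  · intro r s hrs
    fin_cases r <;> fin_cases s <;> first | assumption | exact absurd hrs (by decide)

/-- The Jacobian criterion for the inflection ideal at a smooth point of a curve. -/
theorem exists_mem_smoothLocus_chartIdeal {e : ℕ} {x : Exps (e + 2) ⊕ Fin 3 → ℂ}
    {m : Exps (e + 2)} {k : Fin 3} (hm : x (Sum.inl m) = 1) (hk : x (Sum.inr k) = 1)
    (hF : eval x (universalForm (e + 2)) = 0) (hH : eval x (hessianForm (e + 2)) = 0)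
    {i : Fin 3} (hi : eval x (pderiv (Sum.inr i) (universalForm (e + 2))) ≠ 0) :
    ∃ p : PrimeSpectrum (CoeffCoordRing (e + 2) ⧸ chartIdeal (inflectionIdeal (e + 2)) m k),
      p.asIdeal.comap (Ideal.Quotient.mk (chartIdeal (inflectionIdeal (e + 2)) m k)) =
        RingHom.ker (eval x) ∧
      p ∈ Algebra.smoothLocus ℂ
        (CoeffCoordRing (e + 2) ⧸ chartIdeal (inflectionIdeal (e + 2)) m k) := by
  -- As `z_k = 1` at the point, the form `z_k^(e+2)` takes the value 1 there, so this direction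
  -- moves `F`.
  obtain ⟨δ₁, hδ₁⟩ := exists_coeffForm_eq (d := e + 2) (G := X k ^ (e + 2))
    (isHomogeneous_X_pow k (e + 2))
  have h11 : eval x (paramDerivation δ₁ (universalForm (e + 2))) = 1 := by
    rw [eval_paramDerivation_universalForm, hδ₁, map_pow, eval_X, hk, one_pow]
  obtain ⟨δ₂, h21, h22⟩ := exists_paramDerivation_hessianForm_ne_zero hk hF hi
  have hEa : ∀ {p : CoeffCoordRing (e + 2)} {n : ℕ}, p.IsWeightedHomogeneous (paramWeight (e + 2)) n →
      eval x (weightedEuler (paramWeight (e + 2)) p) = n * eval x p := fun {p n} hp => by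
    rw [weightedEuler_eq hp, nsmul_eq_mul, map_mul, map_natCast]
  have hEz : ∀ {p : CoeffCoordRing (e + 2)} {n : ℕ}, p.IsWeightedHomogeneous (coordWeight (e + 2)) n →
      eval x (weightedEuler (coordWeight (e + 2)) p) = n * eval x p := fun {p n} hp => by
    rw [weightedEuler_eq hp, nsmul_eq_mul, map_mul, map_natCast]
  have hFa := hEa (universalForm_paramWeight (e + 2))
  have hHa := hEa (hessianForm_paramWeight (e + 2))
  have hFz := hEz (universalForm_coordWeight (e + 2))
  have hHz := hEz (hessianForm_coordWeight e)
  have haz := hEz (isWeightedHomogeneous_X ℂ (coordWeight (e + 2)) (Sum.inl m))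
  have haa := hEa (isWeightedHomogeneous_X ℂ (paramWeight (e + 2)) (Sum.inl m))
  have hzz := hEz (isWeightedHomogeneous_X ℂ (coordWeight (e + 2)) (Sum.inr k))
  rw [hF, mul_zero] at hFa hFz
  rw [hH, mul_zero] at hHa hHz
  simp only [eval_X, hm, hk, paramWeight, coordWeight, Sum.elim_inl, Sum.elim_inr,
    Nat.cast_zero, Nat.cast_one, mul_one] at haz haa hzz
  -- The order of equations and derivations makes the Jacobian upper triangular. The entries above
  -- the diagonal, such as the effect of `δ₁` on the Hessian or on `a_m - 1`, are irrelevant.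
  refine exists_mem_smoothLocus_of_det_ne_zero
    ![universalForm (e + 2), hessianForm (e + 2), X (Sum.inl m) - 1, X (Sum.inr k) - 1]
    ![paramDerivation δ₁, paramDerivation δ₂, weightedEuler (paramWeight (e + 2)),
      weightedEuler (coordWeight (e + 2))] x ?_ ?_ ?_
  · intro j
    fin_cases j
    · exact hF
    · exact hH
    · simp [hm]
    · simp [hk]
  · refine det_ne_zero_of_upper_fin_four ?_ ?_ ?_ ?_ ?_ ?_ ?_ ?_ ?_ ?_ <;>
      simp only [of_apply, cons_val, map_sub, Derivation.map_one_eq_zero, sub_zero]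
    · exact h21
    · exact hFa
    · exact hHa
    · exact hFz
    · exact hHz
    · exact haz
    · exact h11.trans_ne one_ne_zero
    · exact h22
    · exact haa.trans_ne one_ne_zero
    · exact hzz.trans_ne one_ne_zero
  · rw [chartIdeal, inflectionIdeal, ← Ideal.span_union, range_cons, range_cons, range_cons,
      range_cons, range_empty, Set.union_empty, Set.insert_eq, Set.insert_eq, Set.union_assoc]

end

end PlaneInflection

/-! ### From representatives of projective points to the affine charts. -/

namespace PlaneInflection

open MvPolynomial Matrix

noncomputable section

variable {d : ℕ}

lemma pderiv_specialize (a : Exps d → ℂ) (i : Fin 3) (p : CoeffCoordRing d) :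
    pderiv i (aeval (Sum.elim (fun m => C (a m)) X :
      Exps d ⊕ Fin 3 → MvPolynomial (Fin 3) ℂ) p) =
    aeval (Sum.elim (fun m => C (a m)) X) (pderiv (Sum.inr i) p) := by
  classical
  induction p using MvPolynomial.induction_on with
  | C r => simp [MvPolynomial.algebraMap_eq]
  | add p q hp hq => simp only [map_add, hp, hq]
  | mul_X p s hp =>
    rw [map_mul, Derivation.leibniz, hp, Derivation.leibniz, map_add, smul_eq_mul, smul_eq_mul,
      smul_eq_mul, smul_eq_mul, map_mul, map_mul]
    congr 2
    rcases s with m | k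
    · simp [pderiv_X]
    · simp only [aeval_X, Sum.elim_inr, pderiv_X, Pi.single_apply, Sum.inr.injEq]
      split_ifs <;> simp

lemma eval_specialize (a : Exps d → ℂ) (z : Fin 3 → ℂ) (p : CoeffCoordRing d) :
    eval z (aeval (Sum.elim (fun m => C (a m)) X :
      Exps d ⊕ Fin 3 → MvPolynomial (Fin 3) ℂ) p) = eval (Sum.elim a z) p := by
  induction p using MvPolynomial.induction_on with
  | C r => simp [MvPolynomial.algebraMap_eq]
  | add p q hp hq => simp only [map_add, hp, hq]
  | mul_X p s hp =>
    rw [map_mul, map_mul, hp, map_mul]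
    rcases s with m | k <;> simp

lemma eval_curveForm (a : CurveSpace d) (z : Fin 3 → ℂ) :
    eval z (curveForm a) = eval (Sum.elim a.rep z) (universalForm d) :=
  eval_specialize _ _ _

lemma eval_pderiv_curveForm (a : CurveSpace d) (z : Fin 3 → ℂ) (i : Fin 3) :
    eval z (pderiv i (curveForm a)) =
      eval (Sum.elim a.rep z) (pderiv (Sum.inr i) (universalForm d)) := by
  rw [curveForm, pderiv_specialize, eval_specialize]

lemma eval_pderiv_pderiv_curveForm (a : CurveSpace d) (z : Fin 3 → ℂ) (i j : Fin 3) :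
    eval z (pderiv i (pderiv j (curveForm a))) = hessianMatrix (Sum.elim a.rep z) i j := by
  rw [curveForm, pderiv_specialize, pderiv_specialize, eval_specialize, hessianMatrix, of_apply]

/-- The Hessian vanishes at inflection points. -/
lemma IsInflectionPoint.eval_hessianForm {e r : ℕ} {a : CurveSpace (e + 2)} {z : Plane}
    (h : IsInflectionPoint r a z) :
    eval (Sum.elim a.rep z.rep) (hessianForm (e + 2)) = 0 := by
  obtain ⟨hr, hF, -, q, hzq, htan, hq⟩ := h
  rw [eval_curveForm] at hF
  -- Contact `r + 2 ≥ 3` makes `q` isotropic; below, tangency makes `q` orthogonal to `z` for the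
  -- Hessian.
  have hqq := sum_hessian_eq_zero_of_lineIntersectionNumber (F := curveForm a) (p := z.rep)
    (q := q) (by rw [hq]; exact_mod_cast (by omega : 3 ≤ r + 2))
  rw [← det_hessianMatrix]
  refine det_eq_zero_of_isotropic (hessianMatrix_isSymm _) hzq
    (dotProduct_hessianMatrix_mulVec hF) ?_ ?_
  · have hg := hessianMatrix_mulVec (Sum.elim a.rep z.rep)
    simp only [eval_pderiv_curveForm] at htan
    calc q ⬝ᵥ hessianMatrix (Sum.elim a.rep z.rep) *ᵥ z.rep
        = ∑ i, q i * (((e : ℂ) + 1) * eval (Sum.elim a.rep z.rep)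
            (pderiv (Sum.inr i) (universalForm (e + 2)))) :=
          Finset.sum_congr rfl fun i _ => congrArg (q i * ·) (hg i)
      _ = ((e : ℂ) + 1) * ∑ i, eval (Sum.elim a.rep z.rep)
            (pderiv (Sum.inr i) (universalForm (e + 2))) * q i := by
          rw [Finset.mul_sum]
          exact Finset.sum_congr rfl fun i _ => by ring
      _ = 0 := by rw [htan, mul_zero]
  · rw [← hqq]
    simp only [dotProduct, mulVec, eval_pderiv_pderiv_curveForm, Finset.mul_sum]
    exact Finset.sum_congr rfl fun i _ => Finset.sum_congr rfl fun j _ => by ring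

/-- Bihomogeneity makes both vanishing and non-vanishing independent of the chosen representatives.
-/
lemma eval_chartPoint {p : CoeffCoordRing d} {n n' : ℕ}
    (hp : p.IsWeightedHomogeneous (paramWeight d) n)
    (hp' : p.IsWeightedHomogeneous (coordWeight d) n')
    (a : CurveSpace d) (z : Plane) (m : Exps d) (k : Fin 3) :
    eval (chartPoint a z m k) p =
      (a.rep m)⁻¹ ^ n * ((z.rep k)⁻¹ ^ n' * eval (Sum.elim a.rep z.rep) p) := by
  rw [← eval_weighted_scale hp', ← eval_weighted_scale hp]
  congr 2
  funext s
  rcases s with s | s <;> simp [chartPoint, paramWeight, coordWeight, div_eq_inv_mul]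

/-- The inflection scheme is smooth at every inflection point. -/
theorem IsInflectionPoint.isSmoothPoint {r : ℕ} (hd : 2 ≤ d) {a : CurveSpace d} {z : Plane}
    (h : IsInflectionPoint r a z) : IsSmoothPoint (inflectionIdeal d) a z := by
  obtain ⟨e, rfl⟩ := Nat.exists_eq_add_of_le' hd
  intro m k hm hk
  have hH := h.eval_hessianForm
  obtain ⟨-, hF, ⟨i, hi⟩, -⟩ := h
  rw [eval_curveForm] at hF
  rw [eval_pderiv_curveForm] at hi
  refine exists_mem_smoothLocus_chartIdeal (x := chartPoint a z m k) (i := i) ?_ ?_ ?_ ?_ ?_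
  · exact div_self hm
  · exact div_self hk
  · rw [eval_chartPoint (universalForm_paramWeight _) (universalForm_coordWeight _), hF,
      mul_zero, mul_zero]
  · rw [eval_chartPoint (hessianForm_paramWeight _) (hessianForm_coordWeight e), hH,
      mul_zero, mul_zero]
  · rw [eval_chartPoint (pderiv_paramWeight (universalForm_paramWeight _) i)
      (pderiv_coordWeight (n := e + 1) (universalForm_coordWeight (e + 2)) i)]
    exact mul_ne_zero (pow_ne_zero _ (inv_ne_zero hm))
      (mul_ne_zero (pow_ne_zero _ (inv_ne_zero hk)) hi)

end

end PlaneInflection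

/-- The argument needs only that the inflection point is a smooth point of the curve, so the excluded
loci do not enter. -/
theorem mainTheorem5 (d : ℕ) (hd : 4 ≤ d)
    (a₀ : PlaneInflection.CurveSpace d)
    (ha₀ : a₀ ∈ PlaneInflection.openMultipleInflectionCurves d)
    (z₀ : PlaneInflection.Plane)
    (hz₀ : PlaneInflection.IsInflectionPoint 2 a₀ z₀) :
    PlaneInflection.IsSmoothPoint (PlaneInflection.inflectionIdeal d) a₀ z₀ :=
  hz₀.isSmoothPoint (le_trans (by decide) hd)
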